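/- **Setting.** Let $\mathbb{D}$ be a locally compact subset of a finite-dimensional Euclidean space. Let $\mathrm{USC}(\mathbb{D})$ be the set of upper semicontinuous functions $\mathbb{D}\to[-\infty,\infty]$ with the hypo-topology, that is, the topology induced by the Fell (hit-and-miss) topology on closed subsets of $\mathbb{D}\times\mathbb{R}$ through $x\mapsto\operatorname{hypo}x=\{(s,\alpha):\alpha\le x(s)\}$, and with its Borel $\sigma$-field. A *usc process* is a measurable map from a probability space into $\mathrm{USC}(\mathbb{D})$. For $\theta=(\gamma,\mu,\sigma)\in\Theta=\mathbb{R}\times\mathbb{R}\times(0,\infty)$ let $F(\cdot;\theta)$ be the GEV distribution function on $[-\infty,\infty]$: $F(x;\theta)=\exp[-\{1+\gamma(x-\mu)/\sigma\}^{-1/\gamma}]$ if $\gamma\ne0$ and $\sigma+\gamma(x-\mu)>0$; $F(x;\theta)=\exp[-\exp\{-(x-\mu)/\sigma\}]$ if $\gamma=0$; $F(\cdot;\theta)$ is $0$ to the left and $1$ to the right of the support, $F(-\infty;\theta)=0$ and $F(\infty;\theta)=1$. Let $Q(p;\theta)=\sup\{x\in\mathbb{R}:F(x;\theta)\le p\}$,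 $p\in[0,1]$, be its right-continuous quantile function (with $\sup\varnothing=-\infty$, so $Q(0;\theta)$ is the lower endpoint and $Q(1;\theta)=\infty$). Let $\Phi=F(\cdot;1,1,1)$ be the unit-Fréchet distribution function. Put $-1/\log 0=0$ and $-1/\log 1=\infty$. A usc process $\xi$ is *max-stable* if for every integer $n\ge1$ there are functions $a_n:\mathbb{D}\to(0,\infty)$ and $b_n:\mathbb{D}\to\mathbb{R}$ such that $a_n\xi+b_n$ is a usc process and, for all iid usc processes $\xi_1,\dots,\xi_n$ with the same law as $\xi$, the processes $\bigvee_{i=1}^n\xi_i$ and $a_n\xi+b_n$ have the same law on $\mathrm{USC}(\mathbb{D})$. It is *simple* max-stable if, in addition, $\Pr[\xi(s)\le x]=\Phi(x)$ for all $s\in\mathbb{D}$ and $x\in\mathbb{R}$. **Proposition (à la Sklar II for max-stable processes).** Let $\theta:\mathbb{D}\to\Theta$ be continuous and let $\xi$ be a usc process with $\operatorname{GEV}(\theta(s))$ margins, i.e. $\Pr[\xi(s)\le x]=F(x;\theta(s))$ for all $s\in\mathbb{D}$, $x\in\mathbb{R}$. Assume that for every compact $K\subset\mathbb{D}$, $\sup_{s\in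 K}F(\xi(s);\theta(s))<1$ with probability one. Then $$\xi^*(s)=-1/\log F(\xi(s);\theta(s))\quad\text{and}\quad\tilde\xi(s)=Q(\Phi(\xi^*(s));\theta(s)),\qquad s\in\mathbb{D},$$ define usc processes, and almost surely $\xi(s)=\tilde\xi(s)$ for all $s\in\mathbb{D}$. Moreover, $\xi$ is max-stable if and only if $\xi^*$ is simple max-stable. -/

import Mathlib

open MeasureTheory ProbabilityTheory TopologicalSpace

/-- The Fell hit-and-miss topology on the closed subsets of `X`: generated by the families of closed
sets that miss a given compact set and the families of closed sets that hit a given open set. -/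
abbrev fellTopology (X : Type*) [TopologicalSpace X] : TopologicalSpace (Closeds X) :=
  generateFrom
    ({S | ∃ K : Set X, IsCompact K ∧ S = {F : Closeds X | (F : Set X) ∩ K = ∅}} ∪
      {S | ∃ G : Set X, IsOpen G ∧ S = {F : Closeds X | ((F : Set X) ∩ G).Nonempty}})

/-- The space `USC(D)` of upper semicontinuous functions `D → [-∞, ∞]`. -/
structure USC (D : Type*) [TopologicalSpace D] where
  /-- The underlying function. -/
  toFun : D → EReal
  /-- Upper semicontinuity. -/
  usc : UpperSemicontinuous toFun

namespace USC

variable {D : Type*} [TopologicalSpace D]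

instance : CoeFun (USC D) (fun _ => D → EReal) := ⟨USC.toFun⟩

/-- The hypograph `{(s, α) ∈ D × ℝ : α ≤ x(s)}`, a closed subset of `D × ℝ`. -/
def hypo (x : USC D) : Closeds (D × ℝ) where
  carrier := {p | (p.2 : EReal) ≤ x p.1}
  isClosed' :=
    (upperSemicontinuous_iff_IsClosed_hypograph.mp x.usc).preimage
      (continuous_fst.prodMk (continuous_coe_real_ereal.comp continuous_snd))

/-- The hypo-topology: the trace of the Fell topology through `x ↦ hypo x`. -/
instance : TopologicalSpace (USC D) := (fellTopology (D × ℝ)).induced hypo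

/-- The σ-field of hypo-measurable sets. -/
instance : MeasurableSpace (USC D) := borel (USC D)

instance : BorelSpace (USC D) := ⟨rfl⟩

/-- The pointwise maximum of finitely many usc functions. -/
noncomputable def max {ι : Type*} [Finite ι] (x : ι → USC D) : USC D where
  toFun s := ⨆ i, x i s
  usc := by
    intro s y hy
    have h : ∀ i, ∀ᶠ t in nhds s, x i t < y := fun i =>
      (x i).usc s y ((le_iSup (fun i => x i s) i).trans_lt hy)
    filter_upwards [Filter.eventually_all.mpr h] with t ht
    rcases isEmpty_or_nonempty ι with hι | hι
    · exact lt_of_le_of_lt (by simp) hy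
    · obtain ⟨i, hi⟩ := exists_eq_ciSup_of_finite (f := fun i => x i t)
      rw [← hi]
      exact ht i

end USC

/-- The GEV parameters `θ = (γ, μ, σ) ∈ ℝ × ℝ × (0, ∞)`, with the product topology. -/
abbrev GEVParam : Type := ℝ × ℝ × Set.Ioi (0 : ℝ)

noncomputable section

/-- The GEV distribution function on `ℝ`; off the support `{x : σ + γ (x - μ) > 0}` it is `0` to the
left of the support (`γ > 0`) and `1` to the right of it (`γ < 0`). -/
def gevCDFReal (θ : GEVParam) (x : ℝ) : ℝ :=
  let γ := θ.1
  let μ := θ.2.1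
  let σ : ℝ := θ.2.2
  if γ = 0 then Real.exp (-Real.exp (-((x - μ) / σ)))
  else if 0 < σ + γ * (x - μ) then Real.exp (-(1 + γ * (x - μ) / σ) ^ (-1 / γ))
  else if 0 < γ then 0 else 1

/-- The GEV distribution function `F(x; θ)`, `x ∈ [-∞, ∞]`. -/
def gevCDF (θ : GEVParam) (x : EReal) : ℝ :=
  if x = ⊥ then 0 else if x = ⊤ then 1 else gevCDFReal θ x.toReal

/-- The right-continuous GEV quantile function `Q(p; θ) = sup {x ∈ ℝ : F(x; θ) ≤ p}`, `p ∈ [0, 1]`,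
in closed form; `Q(0; θ)` is the lower endpoint of the support and `Q(1; θ) = ∞`. -/
def gevQuantile (p : ℝ) (θ : GEVParam) : EReal :=
  let γ := θ.1
  let μ := θ.2.1
  let σ : ℝ := θ.2.2
  if p ≤ 0 then (if 0 < γ then ((μ - σ / γ : ℝ) : EReal) else ⊥)
  else if 1 ≤ p then ⊤
  else if γ = 0 then ((μ + σ * Real.log (-1 / Real.log p) : ℝ) : EReal)
  else ((μ + σ * ((-1 / Real.log p) ^ γ - 1) / γ : ℝ) : EReal)

/-- The parameter `(1, 1, 1)` of the unit-Fréchet distribution. -/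
def unitFrechetParam : GEVParam := (1, 1, ⟨1, Set.mem_Ioi.mpr one_pos⟩)

/-- The unit-Fréchet distribution function `Φ = F(·; 1, 1, 1)`. -/
def unitFrechetCDF (x : EReal) : ℝ := gevCDF unitFrechetParam x

/-- The map `p ↦ -1 / log p` from `[0, 1]` to `[0, ∞]`, with values `0` at `0` and `∞` at `1`. -/
def negInvLog (p : ℝ) : EReal :=
  if p ≤ 0 then 0 else if 1 ≤ p then ⊤ else ((-1 / Real.log p : ℝ) : EReal)

end

section Processes

variable {D : Type*} [TopologicalSpace D] {Ω : Type*} [MeasurableSpace Ω]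

/-- The marginal distribution of `ξ(s)` is `GEV(θ(s))` for every `s`. -/
def HasGEVMargins (P : Measure Ω) (ξ : Ω → USC D) (θ : D → GEVParam) : Prop :=
  ∀ (s : D) (x : ℝ), P {ω | ξ ω s ≤ (x : EReal)} = ENNReal.ofReal (gevCDF (θ s) x)

/-- Max-stability of a usc process `ξ` under `P`: for every `n ≥ 1` there are functions
`a : D → (0, ∞)` and `b : D → ℝ` such that `η = a ξ + b` is a usc process, and for every vector
of `n` iid usc processes `ζ 0, …, ζ (n - 1)` with the same law as `ξ` the maximum of the `ζ i` has
the same law on `USC(D)` as `a ξ + b`. (Whether this holds depends only on the law of the vector `ζ`,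
so for `D` in `Type` it is enough to let `ζ` live on probability spaces in `Type`.) -/
def MaxStable {D : Type} [TopologicalSpace D] (P : Measure Ω) (ξ : Ω → USC D) : Prop :=
  ∀ n : ℕ, 1 ≤ n → ∃ (a b : D → ℝ) (η : Ω → USC D),
    (∀ s, 0 < a s) ∧
    Measurable η ∧ (∀ ω s, η ω s = (a s : EReal) * ξ ω s + (b s : EReal)) ∧
    ∀ (Ω' : Type) (_ : MeasurableSpace Ω') (P' : Measure Ω') (_ : IsProbabilityMeasure P')
      (ζ : Fin n → Ω' → USC D),
      (∀ i, Measurable (ζ i)) → iIndepFun ζ P' → (∀ i, P'.map (ζ i) = P.map ξ) →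
      P'.map (fun ω => USC.max (fun i => ζ i ω)) = P.map η

/-- A simple max-stable usc process: max-stable with unit-Fréchet margins. -/
def SimpleMaxStable {D : Type} [TopologicalSpace D] (P : Measure Ω) (ξ : Ω → USC D) : Prop :=
  MaxStable P ξ ∧
    ∀ (s : D) (x : ℝ), P {ω | ξ ω s ≤ (x : EReal)} = ENNReal.ofReal (unitFrechetCDF x)

end Processes

/-! Let `T` send a usc function `x` to `s ↦ -1/log F(x(s); θ(s))` and let `T'` send it to `s ↦
Q(Φ(x(s)); θ(s))`. Both compose `x` pointwise with nondecreasing maps `g s`. The Galois relation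
`gevQuantile_lt_iff`, together with continuity of `F` in each argument, makes `g s (x s) < α`
equivalent to `x s < h s` for a lower semicontinuous `h`. Hence `T` and `T'` preserve upper
semicontinuity. They are measurable because `{x | x < h on K}` is open for compact `K` and such sets
determine the σ-field (`isOpen_setOf_forall_lt`, `measurable_of_forall_compact`). Being monotone,
they commute with finite maxima and so transport the law of a maximum of iid copies
(`map_max_pi_map_comp`).

Almost surely `T' (T ξ) = ξ` (`ae_forall_gevQuantile_gevCDF`): the supremum condition excludes `F =
1`, and semicontinuity extends control of the lower endpoint from a countable dense set to all
points.

Max-stability passes between the two scales because comparing margins gives `F(a y + b)^n = F(y)`.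
Thus any normalization of `ξ` becomes multiplication by `n` after `T`. Conversely, on the Fréchet
scale `a = n` and `b = 0` are forced, and `T'` turns multiplication by `n` into the GEV
normalization, which is continuous in `s`. -/

namespace USC

/-! ### Hypo-topology: open sets, countable subbasis, measurability criterion. -/

section Topology

variable {D : Type*} [TopologicalSpace D]

theorem ext_of_forall {x y : USC D} (h : ∀ s, x s = y s) : x = y := by
  cases x; cases y
  congr
  exact funext h

theorem isOpen_setOf_forall_lt_real {K : Set D} (hK : IsCompact K) (q : ℝ) :
    IsOpen {x : USC D | ∀ s ∈ K, x s < (q : EReal)} := by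
  let _ := fellTopology (D × ℝ)
  refine isOpen_induced_iff.mpr ⟨{F : Closeds (D × ℝ) | (F : Set (D × ℝ)) ∩ (K ×ˢ {q}) = ∅},
    isOpen_generateFrom_of_mem (Or.inl ⟨_, hK.prod isCompact_singleton, rfl⟩), ?_⟩
  ext x
  simp only [Set.mem_preimage, Set.mem_ofPred_eq, Set.eq_empty_iff_forall_notMem]
  constructor
  · intro h s hs
    by_contra hc
    exact h (s, q) ⟨not_lt.mp hc, hs, rfl⟩
  · rintro h ⟨s, r⟩ ⟨h1, h2, h3⟩
    obtain rfl : r = q := h3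
    exact absurd (show ((r : ℝ) : EReal) ≤ x s from h1) (not_le.mpr (h s h2))

theorem isOpen_setOf_exists_lt_real {U : Set D} (hU : IsOpen U) (q : ℝ) :
    IsOpen {x : USC D | ∃ s ∈ U, (q : EReal) < x s} := by
  let _ := fellTopology (D × ℝ)
  refine isOpen_induced_iff.mpr
    ⟨{F : Closeds (D × ℝ) | ((F : Set (D × ℝ)) ∩ (U ×ˢ Set.Ioi q)).Nonempty},
    isOpen_generateFrom_of_mem (Or.inr ⟨_, hU.prod isOpen_Ioi, rfl⟩), ?_⟩
  ext x
  simp only [Set.mem_preimage, Set.mem_ofPred_eq]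
  constructor
  · rintro ⟨⟨s, r⟩, h1, h2, h3⟩
    exact ⟨s, h2, lt_of_lt_of_le (EReal.coe_lt_coe_iff.mpr h3) h1⟩
  · rintro ⟨s, hs, h⟩
    obtain ⟨r, h1, h2⟩ := EReal.lt_iff_exists_real_btwn.mp h
    exact ⟨(s, r), h2.le, hs, EReal.coe_lt_coe_iff.mp h1⟩

/-- Sets of usc functions lying below a lower semicontinuous bound on a compact set are open. -/
theorem isOpen_setOf_forall_lt [LocallyCompactSpace D] {K : Set D} (hK : IsCompact K)
    {h : D → EReal} (hh : LowerSemicontinuous h) :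
    IsOpen {x : USC D | ∀ s ∈ K, x s < h s} := by
  rw [isOpen_iff_forall_mem_open]
  intro x hx
  suffices H : ∃ W : Set (USC D), IsOpen W ∧ x ∈ W ∧ ∀ y ∈ W, ∀ s ∈ K, y s < h s by
    obtain ⟨W, h1, h2, h3⟩ := H
    exact ⟨W, h3, h1, h2⟩
  refine hK.induction_on
    (p := fun A => ∃ W : Set (USC D), IsOpen W ∧ x ∈ W ∧ ∀ y ∈ W, ∀ s ∈ A, y s < h s) ?_ ?_ ?_ ?_
  · exact ⟨Set.univ, isOpen_univ, trivial, by simp⟩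
  · rintro A B hAB ⟨W, h1, h2, h3⟩
    exact ⟨W, h1, h2, fun y hy s hs => h3 y hy s (hAB hs)⟩
  · rintro A B ⟨V, h1, h2, h3⟩ ⟨W, h4, h5, h6⟩
    exact ⟨V ∩ W, h1.inter h4, ⟨h2, h5⟩, fun y hy s hs => hs.elim (h3 y hy.1 s) (h6 y hy.2 s)⟩
  · intro s hs
    -- A constant `q` separates `x` from `h` on a compact neighbourhood of `s`, which reduces to the
    -- case of a constant bound.
    obtain ⟨q, h1, h2⟩ := EReal.lt_iff_exists_real_btwn.mp (hx s hs)
    obtain ⟨C, hC, hCU, hCc⟩ := local_compact_nhds ((x.usc s q h1).and (hh s q h2))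
    exact ⟨C, mem_nhdsWithin_of_mem_nhds hC, _, isOpen_setOf_forall_lt_real hCc q,
      fun t ht => (hCU ht).1, fun y hy t ht => (hy t ht).trans (hCU ht).2⟩

theorem measurable_eval [LocallyCompactSpace D] (s : D) : Measurable fun x : USC D => x s := by
  refine measurable_of_Iio fun α => ?_
  have := isOpen_setOf_forall_lt (isCompact_singleton (x := s))
    (h := fun _ => α) lowerSemicontinuous_const
  convert this.measurableSet using 1
  ext x
  simp

theorem exists_countableBasis_closure_subset [LocallyCompactSpace D] [SecondCountableTopology D]
    [T2Space D] {s : D} {U : Set D} (hU : U ∈ nhds s) :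
    ∃ B ∈ countableBasis D, s ∈ B ∧ IsCompact (closure B) ∧ closure B ⊆ U := by
  obtain ⟨C, hC, hCU, hCc⟩ := local_compact_nhds hU
  obtain ⟨B, hB, hs, hBC⟩ := (isBasis_countableBasis D).mem_nhds_iff.mp hC
  have h := closure_minimal hBC hCc.isClosed
  exact ⟨B, hB, hs, hCc.of_isClosed_subset isClosed_closure h, h.trans hCU⟩

variable (D) in
/-- A countable subbasis of the hypo-topology. -/
def subbasis [SecondCountableTopology D] : Set (Set (USC D)) :=
  (fun p : Set D × ℚ => {x : USC D | ∀ s ∈ closure p.1, x s < ((p.2 : ℝ) : EReal)}) ''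
      ({B ∈ countableBasis D | IsCompact (closure B)} ×ˢ Set.univ) ∪
    (fun p : Set D × ℚ => {x : USC D | ∃ s ∈ p.1, ((p.2 : ℝ) : EReal) < x s}) ''
      (countableBasis D ×ˢ Set.univ)

theorem countable_subbasis [SecondCountableTopology D] : (subbasis D).Countable :=
  ((((countable_countableBasis D).mono (Set.sep_subset _ _)).prod Set.countable_univ).image _).union
    (((countable_countableBasis D).prod Set.countable_univ).image _)

theorem isOpen_of_mem_subbasis [SecondCountableTopology D] {S : Set (USC D)}
    (hS : S ∈ subbasis D) : IsOpen S := by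
  rcases hS with ⟨⟨B, q⟩, ⟨⟨_, hB⟩, _⟩, rfl⟩ | ⟨⟨B, q⟩, ⟨hB, _⟩, rfl⟩
  · exact isOpen_setOf_forall_lt_real hB _
  · exact isOpen_setOf_exists_lt_real (isOpen_of_mem_countableBasis hB) _

variable [LocallyCompactSpace D] [SecondCountableTopology D] [T2Space D]

/-- A missed compact set is covered by finitely many boxes `B ×ˢ Ioi q` with `x < q` on the compact
closure of `B`. A hit open set needs only one basic open set and one rational level, since
hypographs are closed downwards. -/
theorem topology_eq_generateFrom_subbasis :
    (inferInstance : TopologicalSpace (USC D)) = generateFrom (subbasis D) := by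
  refine le_antisymm (le_generateFrom fun S hS => isOpen_of_mem_subbasis hS) ?_
  change _ ≤ (fellTopology (D × ℝ)).induced hypo
  rw [fellTopology, induced_generateFrom_eq]
  refine le_generateFrom ?_
  rintro _ ⟨_, ⟨K, hK, rfl⟩ | ⟨G, hG, rfl⟩, rfl⟩
  · let _ := generateFrom (subbasis D)
    rw [isOpen_iff_forall_mem_open]
    intro x hx
    have hlt : ∀ p ∈ K, x p.1 < (p.2 : EReal) := fun p hp => by
      by_contra hc
      exact Set.eq_empty_iff_forall_notMem.mp hx p ⟨not_lt.mp hc, hp⟩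
    suffices H : ∃ W : Set (USC D), IsOpen W ∧ x ∈ W ∧ ∀ y ∈ W, ∀ p ∈ K, y p.1 < (p.2 : EReal) by
      obtain ⟨W, h1, h2, h3⟩ := H
      refine ⟨W, fun y hy => Set.eq_empty_iff_forall_notMem.mpr ?_, h1, h2⟩
      rintro p ⟨hp1, hp2⟩
      exact absurd (show (p.2 : EReal) ≤ y p.1 from hp1) (not_le.mpr (h3 y hy p hp2))
    refine hK.induction_on (p := fun A =>
      ∃ W : Set (USC D), IsOpen W ∧ x ∈ W ∧ ∀ y ∈ W, ∀ p ∈ A, y p.1 < (p.2 : EReal)) ?_ ?_ ?_ ?_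
    · exact ⟨Set.univ, isOpen_univ, trivial, by simp⟩
    · rintro A B hAB ⟨W, h1, h2, h3⟩
      exact ⟨W, h1, h2, fun y hy s hs => h3 y hy s (hAB hs)⟩
    · rintro A B ⟨V, h1, h2, h3⟩ ⟨W, h4, h5, h6⟩
      exact ⟨V ∩ W, h1.inter h4, ⟨h2, h5⟩, fun y hy s hs => hs.elim (h3 y hy.1 s) (h6 y hy.2 s)⟩
    · rintro ⟨s, r⟩ hp
      obtain ⟨q, h1, h2⟩ := EReal.lt_iff_exists_rat_btwn.mp (hlt _ hp)
      obtain ⟨B, hB, hsB, hBc, hBU⟩ := exists_countableBasis_closure_subset (x.usc s _ h1)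
      refine ⟨B ×ˢ Set.Ioi (q : ℝ), mem_nhdsWithin_of_mem_nhds
        (prod_mem_nhds ((isOpen_of_mem_countableBasis hB).mem_nhds hsB)
          (isOpen_Ioi.mem_nhds (EReal.coe_lt_coe_iff.mp h2))), _,
        isOpen_generateFrom_of_mem (Or.inl ⟨(B, q), ⟨⟨hB, hBc⟩, trivial⟩, rfl⟩),
        fun t ht => hBU ht, ?_⟩
      rintro y hy ⟨t, r'⟩ ⟨h3, h4⟩
      exact (hy t (subset_closure h3)).trans (EReal.coe_lt_coe_iff.mpr h4)
  · let _ := generateFrom (subbasis D)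
    rw [isOpen_iff_forall_mem_open]
    rintro x ⟨⟨s, r⟩, h1, h2⟩
    obtain ⟨U, hU, V, hV, hUV⟩ := mem_nhds_prod_iff.mp (hG.mem_nhds h2)
    obtain ⟨B, hB, hsB, hBU⟩ := (isBasis_countableBasis D).mem_nhds_iff.mp hU
    obtain ⟨l, hl, hlV⟩ := exists_Ioc_subset_of_mem_nhds hV ⟨r - 1, by simp⟩
    obtain ⟨q, hq1, hq2⟩ := exists_rat_btwn hl
    refine ⟨_, ?_, isOpen_generateFrom_of_mem (Or.inr ⟨(B, q), ⟨hB, trivial⟩, rfl⟩),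
      s, hsB, lt_of_lt_of_le (EReal.coe_lt_coe_iff.mpr hq2) h1⟩
    rintro y ⟨t, ht, hty⟩
    obtain ⟨r', h3, h4⟩ := EReal.lt_iff_exists_real_btwn.mp hty
    -- Lowering the height to `min r r'` keeps the point in the hypograph and brings it into `Ioc l
    -- r`.
    refine ⟨(t, min r r'), ?_, hUV ⟨hBU ht, hlV ⟨lt_min (hq1.trans hq2)
      (hq1.trans (EReal.coe_lt_coe_iff.mp h3)), min_le_left _ _⟩⟩⟩
    exact (EReal.coe_le_coe_iff.mpr (min_le_right r r')).trans h4.le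

instance : SecondCountableTopology (USC D) :=
  ⟨⟨subbasis D, countable_subbasis, topology_eq_generateFrom_subbasis⟩⟩

/-- Hypo-measurability is decided by the suprema over compact sets. -/
theorem measurable_of_forall_compact {Ω : Type*} [MeasurableSpace Ω] {f : Ω → USC D}
    (hf : ∀ K : Set D, IsCompact K → ∀ α : ℝ, MeasurableSet {ω | ∀ s ∈ K, f ω s < (α : EReal)}) :
    Measurable f := by
  have h : (inferInstance : MeasurableSpace (USC D)) = MeasurableSpace.generateFrom (subbasis D) :=
    borel_eq_generateFrom_of_subbasis topology_eq_generateFrom_subbasis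
  refine Measurable.mono (measurable_generateFrom (s := subbasis D) ?_) le_rfl h.le
  rintro _ (⟨⟨B, q⟩, ⟨⟨_, hB⟩, _⟩, rfl⟩ | ⟨⟨B, q⟩, ⟨hB, _⟩, rfl⟩)
  · exact hf _ hB _
  -- Exceeding `q` somewhere on `B` means reaching a rational level `r > q` on one of countably many
  -- compact sets inside `B`.
  · have key : f ⁻¹' {x : USC D | ∃ s ∈ B, ((q : ℝ) : EReal) < x s} =
        ⋃ C ∈ {C ∈ countableBasis D | IsCompact (closure C) ∧ closure C ⊆ B},
          ⋃ r ∈ {r : ℚ | q < r}, {ω | ∀ s ∈ closure C, f ω s < ((r : ℝ) : EReal)}ᶜ := by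
      ext ω
      simp only [Set.mem_preimage, Set.mem_ofPred_eq, Set.mem_iUnion, Set.mem_compl_iff, not_forall,
        not_lt, exists_prop]
      constructor
      · rintro ⟨s, hs, h1⟩
        obtain ⟨r, h2, h3⟩ := EReal.lt_iff_exists_rat_btwn.mp h1
        obtain ⟨C, hC, hsC, hCc, hCB⟩ := exists_countableBasis_closure_subset
          ((isOpen_of_mem_countableBasis hB).mem_nhds hs)
        exact ⟨C, ⟨hC, hCc, hCB⟩, r, by exact_mod_cast EReal.coe_lt_coe_iff.mp h2, s,
          subset_closure hsC, h3.le⟩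
      · rintro ⟨C, ⟨_, _, hCB⟩, r, hr, s, hs, h1⟩
        exact ⟨s, hCB hs, lt_of_lt_of_le (EReal.coe_lt_coe_iff.mpr (by exact_mod_cast hr)) h1⟩
    change MeasurableSet (f ⁻¹' {x : USC D | ∃ s ∈ B, ((q : ℝ) : EReal) < x s})
    rw [key]
    exact MeasurableSet.biUnion ((countable_countableBasis D).mono (Set.sep_subset _ _))
      fun C hC => MeasurableSet.biUnion (Set.to_countable _) fun r _ => (hf _ hC.2.1 _).compl

theorem measurable_max {ι : Type*} [Finite ι] :
    Measurable fun x : ι → USC D => USC.max x := by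
  refine measurable_of_forall_compact fun K hK α => ?_
  have : {x : ι → USC D | ∀ s ∈ K, USC.max x s < (α : EReal)} =
      ⋂ i, (fun x => x i) ⁻¹' {x : USC D | ∀ s ∈ K, x s < (α : EReal)} := by
    ext x
    simp only [Set.mem_ofPred_eq, Set.mem_iInter, Set.mem_preimage]
    constructor
    · exact fun h i s hs => (le_iSup (fun i => x i s) i).trans_lt (h s hs)
    · intro h s hs
      change ⨆ i, x i s < (α : EReal)
      rcases isEmpty_or_nonempty ι with hι | hι
      · simp
      · obtain ⟨i, hi⟩ := exists_eq_ciSup_of_finite (f := fun i => x i s)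
        rw [← hi]
        exact h i s hs
  rw [this]
  exact MeasurableSet.iInter fun i =>
    (measurable_pi_apply i) (isOpen_setOf_forall_lt_real hK α).measurableSet

end Topology

/-! ### Pointwise composition with monotone families. -/

section Compose

variable {D : Type*} [TopologicalSpace D]

/-- The conditions on a family `g` of functions under which `s ↦ g s (x s)` is usc for all usc `x`
and depends measurably on `x`. -/
structure IsUSCFamily (g : D → EReal → EReal) : Prop where
  map_top : ∀ s, g s ⊤ = ⊤
  mono : ∀ s, Monotone (g s)
  isOpen_left : ∀ (y : EReal) (α : ℝ), IsOpen {s | g s y < (α : EReal)}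
  isOpen_right : ∀ (s : D) (α : ℝ), IsOpen {y | g s y < (α : EReal)}

/-- The threshold `h s` is the least `y` with `α ≤ g s y`. It is attained because that set is closed
and contains `⊤`, and openness in `s` for fixed `y` makes `h` lower semicontinuous. -/
theorem IsUSCFamily.exists_lowerSemicontinuous {g : D → EReal → EReal} (hg : IsUSCFamily g)
    (α : ℝ) : ∃ h : D → EReal, LowerSemicontinuous h ∧ ∀ s y, g s y < (α : EReal) ↔ y < h s := by
  have key : ∀ s y, g s y < (α : EReal) ↔ y < sInf {y | (α : EReal) ≤ g s y} := by
    intro s y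
    have hc : IsClosed {y | (α : EReal) ≤ g s y} := by
      have := (hg.isOpen_right s α).isClosed_compl
      convert this using 1
      ext y
      simp
    have hm : (α : EReal) ≤ g s (sInf {y | (α : EReal) ≤ g s y}) :=
      hc.sInf_mem ⟨⊤, by simp [hg.map_top s]⟩
    constructor
    · intro h
      by_contra hle
      exact absurd (hm.trans (hg.mono s (not_lt.mp hle))) (not_le.mpr h)
    · intro h
      by_contra hle
      exact absurd h (not_lt.mpr (sInf_le (not_lt.mp hle)))
  refine ⟨fun s => sInf {y | (α : EReal) ≤ g s y}, ?_, key⟩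
  intro s y hy
  filter_upwards [(hg.isOpen_left y α).mem_nhds ((key s y).mpr hy)] with t ht
  exact (key t y).mp ht

/-- The usc function `s ↦ g s (x s)`. -/
def comp (g : D → EReal → EReal) (hg : IsUSCFamily g) (x : USC D) : USC D where
  toFun s := g s (x s)
  usc := by
    intro s z hz
    obtain ⟨α, h1, h2⟩ := EReal.lt_iff_exists_real_btwn.mp hz
    obtain ⟨h, hh, hgh⟩ := hg.exists_lowerSemicontinuous α
    obtain ⟨q, h3, h4⟩ := EReal.lt_iff_exists_real_btwn.mp ((hgh _ _).mp h1)
    filter_upwards [x.usc s q h3, hh s q h4] with t h5 h6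
    exact ((hgh _ _).mpr (h5.trans h6)).trans h2

@[simp]
theorem comp_apply (g : D → EReal → EReal) (hg : IsUSCFamily g) (x : USC D) (s : D) :
    comp g hg x s = g s (x s) := rfl

theorem comp_max {ι : Type*} [Finite ι] [Nonempty ι] (g : D → EReal → EReal) (hg : IsUSCFamily g)
    (x : ι → USC D) : comp g hg (USC.max x) = USC.max fun i => comp g hg (x i) :=
  ext_of_forall fun s => by
    change g s (⨆ i, x i s) = ⨆ i, g s (x i s)
    refine le_antisymm ?_ (iSup_le fun i => hg.mono s (le_iSup (fun i => x i s) i))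
    obtain ⟨i, hi⟩ := exists_eq_ciSup_of_finite (f := fun i => x i s)
    rw [← hi]
    exact le_iSup (fun i => g s (x i s)) i

theorem measurable_comp [LocallyCompactSpace D] [SecondCountableTopology D] [T2Space D]
    (g : D → EReal → EReal) (hg : IsUSCFamily g) : Measurable (comp g hg) := by
  refine measurable_of_forall_compact fun K hK α => ?_
  obtain ⟨h, hh, hgh⟩ := hg.exists_lowerSemicontinuous α
  simp only [comp_apply, hgh]
  exact (isOpen_setOf_forall_lt hK hh).measurableSet

end Compose
end USC

/-! ### GEV distribution and quantile functions, their continuity and max-stability. -/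

section GEV

theorem gevCDF_coe (θ : GEVParam) (z : ℝ) : gevCDF θ z = gevCDFReal θ z := by
  simp [gevCDF]

@[simp]
theorem gevCDF_bot (θ : GEVParam) : gevCDF θ ⊥ = 0 := by simp [gevCDF]

@[simp]
theorem gevCDF_top (θ : GEVParam) : gevCDF θ ⊤ = 1 := by simp [gevCDF]

theorem gevCDF_nonneg (θ : GEVParam) (y : EReal) : 0 ≤ gevCDF θ y := by
  unfold gevCDF gevCDFReal
  dsimp only
  split_ifs <;> positivity

/-- The quantile of the GEV distribution with location `0` and scale `1` in the variable
`w = -1 / log p`. -/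
noncomputable def boxCox (w γ : ℝ) : ℝ := dslope (fun γ => w ^ γ) 0 γ

theorem boxCox_zero {w : ℝ} (hw : 0 < w) : boxCox w 0 = Real.log w := by
  rw [boxCox, dslope_same]
  simpa using ((hasDerivAt_id (0 : ℝ)).const_rpow hw).deriv

theorem boxCox_of_ne (w : ℝ) {γ : ℝ} (hγ : γ ≠ 0) : boxCox w γ = (w ^ γ - 1) / γ := by
  rw [boxCox, dslope_of_ne _ hγ, slope_def_field]
  simp

/-- As a divided slope of `γ ↦ w ^ γ` at `0`, it is continuous at `γ = 0` exactly because that power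
is differentiable there. This joins the Gumbel case to the others. -/
theorem continuous_boxCox {w : ℝ} (hw : 0 < w) : Continuous (boxCox w) := by
  have h : Differentiable ℝ fun γ : ℝ => w ^ γ := fun γ =>
    ((hasDerivAt_id γ).const_rpow hw).differentiableAt
  rw [continuous_iff_continuousAt]
  intro γ
  by_cases hγ : γ = 0
  · subst hγ
    exact continuousAt_dslope_same.mpr (h 0)
  · exact (continuousAt_dslope_of_ne hγ).mpr (h γ).continuousAt

theorem neg_one_div_log_pos {p : ℝ} (h0 : 0 < p) (h1 : p < 1) : 0 < -1 / Real.log p :=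
  div_pos_of_neg_of_neg (by norm_num) (Real.log_neg h0 h1)

theorem gevQuantile_eq_coe {p : ℝ} (h0 : 0 < p) (h1 : p < 1) (θ : GEVParam) :
    gevQuantile p θ = ((θ.2.1 + θ.2.2 * boxCox (-1 / Real.log p) θ.1 : ℝ) : EReal) := by
  unfold gevQuantile
  dsimp only
  rw [if_neg h0.not_ge, if_neg h1.not_ge]
  split_ifs with h
  · rw [h, boxCox_zero (neg_one_div_log_pos h0 h1)]
  · rw [boxCox_of_ne _ h, mul_div_assoc]

theorem gevQuantile_of_nonpos_pos {p : ℝ} (hp : p ≤ 0) {θ : GEVParam} (h : 0 < θ.1) :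
    gevQuantile p θ = ((θ.2.1 - θ.2.2 / θ.1 : ℝ) : EReal) := by
  simp [gevQuantile, hp, h]

theorem gevQuantile_of_nonpos_nonpos {p : ℝ} (hp : p ≤ 0) {θ : GEVParam} (h : θ.1 ≤ 0) :
    gevQuantile p θ = ⊥ := by
  simp [gevQuantile, hp, h.not_gt]

theorem gevQuantile_one (θ : GEVParam) : gevQuantile 1 θ = ⊤ := by
  simp [gevQuantile]

/-- With `w = -1 / log p` one has `p = exp (-1/w)`, so after standardizing `z` both comparisons
become comparisons of positive numbers with `w`. All later order and continuity facts at interior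
levels rest on this. -/
theorem cmp_gevCDFReal {p : ℝ} (h0 : 0 < p) (h1 : p < 1) (θ : GEVParam) (z : ℝ) :
    (θ.2.1 + θ.2.2 * boxCox (-1 / Real.log p) θ.1 < z ↔ p < gevCDFReal θ z) ∧
    (z < θ.2.1 + θ.2.2 * boxCox (-1 / Real.log p) θ.1 ↔ gevCDFReal θ z < p) := by
  obtain ⟨γ, μ, σ, hσ⟩ := θ
  have hσ : 0 < σ := hσ
  have hw := neg_one_div_log_pos h0 h1
  set w := -1 / Real.log p with hwdef
  have hp : p = Real.exp (-w⁻¹) := by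
    rw [hwdef, inv_div, div_neg, div_one, neg_neg, Real.exp_log h0]
  unfold gevCDFReal
  dsimp only
  set x := (z - μ) / σ with hx
  have hz : z = μ + σ * x := by rw [hx]; field_simp; ring
  have e1 : ∀ b : ℝ, (μ + σ * b < z ↔ b < x) ∧ (z < μ + σ * b ↔ x < b) := by
    intro b
    rw [hz]
    simp [hσ]
  rw [(e1 _).1, (e1 _).2]
  split_ifs with hγ hA hg
  · rw [hγ, boxCox_zero hw, hp, Real.exp_lt_exp, Real.exp_lt_exp, neg_lt_neg_iff, neg_lt_neg_iff,
      Real.exp_neg, inv_lt_inv₀ (Real.exp_pos _) hw, inv_lt_inv₀ hw (Real.exp_pos _),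
      Real.log_lt_iff_lt_exp hw, Real.lt_log_iff_exp_lt hw]
    exact ⟨Iff.rfl, Iff.rfl⟩
  · have hA' : 1 + γ * (z - μ) / σ = 1 + γ * x := by rw [hx]; ring
    have hApos : 0 < 1 + γ * x := by
      rw [← hA']
      have : 1 + γ * (z - μ) / σ = (σ + γ * (z - μ)) / σ := by field_simp
      rw [this]
      exact div_pos hA hσ
    -- `v` is the Fréchet-scale counterpart of `x`: `x = (v ^ γ - 1) / γ`, so only `v` and `w` have
    -- to be compared.
    set v := (1 + γ * x) ^ (γ⁻¹) with hv
    have hvpos : 0 < v := Real.rpow_pos_of_pos hApos _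
    have hvA : v ^ γ = 1 + γ * x := by
      rw [hv, ← Real.rpow_mul hApos.le, inv_mul_cancel₀ hγ, Real.rpow_one]
    have hpow : (1 + γ * (z - μ) / σ) ^ (-1 / γ) = v⁻¹ := by
      rw [hA', neg_div, Real.rpow_neg hApos.le, hv, one_div]
    rw [hpow, hp, Real.exp_lt_exp, Real.exp_lt_exp, neg_lt_neg_iff, neg_lt_neg_iff,
      inv_lt_inv₀ hvpos hw, inv_lt_inv₀ hw hvpos, boxCox_of_ne _ hγ]
    have hxv : x = (v ^ γ - 1) / γ := by rw [hvA]; field_simp; ring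
    rw [hxv]
    rcases lt_or_gt_of_ne hγ with hneg | hpos
    · rw [div_lt_div_right_of_neg hneg, div_lt_div_right_of_neg hneg, sub_lt_sub_iff_right,
        sub_lt_sub_iff_right, Real.rpow_lt_rpow_iff_of_neg hvpos hw hneg,
        Real.rpow_lt_rpow_iff_of_neg hw hvpos hneg]
      exact ⟨Iff.rfl, Iff.rfl⟩
    · rw [div_lt_div_iff_of_pos_right hpos, div_lt_div_iff_of_pos_right hpos,
        sub_lt_sub_iff_right, sub_lt_sub_iff_right, Real.rpow_lt_rpow_iff hvpos.le hw.le hpos,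
        Real.rpow_lt_rpow_iff hw.le hvpos.le hpos]
      exact ⟨Iff.rfl, Iff.rfl⟩
  all_goals
    have hA' : 1 + γ * x ≤ 0 := by
      have : 1 + γ * x = (σ + γ * (z - μ)) / σ := by rw [hx]; field_simp
      rw [this]
      exact div_nonpos_of_nonpos_of_nonneg (not_lt.mp hA) hσ.le
    have hwγ : 0 < w ^ γ := Real.rpow_pos_of_pos hw _
    rw [boxCox_of_ne _ hγ]
  · have : x < (w ^ γ - 1) / γ := by rw [lt_div_iff₀ hg]; linarith
    exact ⟨iff_of_false this.not_gt h0.not_gt, iff_of_true this h0⟩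
  · have hg' : γ < 0 := lt_of_le_of_ne (not_lt.mp hg) hγ
    have : (w ^ γ - 1) / γ < x := by rw [div_lt_iff_of_neg hg']; linarith
    exact ⟨iff_of_true this h1, iff_of_false this.not_gt h1.not_gt⟩

theorem gevCDF_le_one (θ : GEVParam) (y : EReal) : gevCDF θ y ≤ 1 := by
  unfold gevCDF gevCDFReal
  dsimp only
  split_ifs with h1 h2 h3 h4 h5
  any_goals norm_num
  · positivity
  · rw [mul_div_assoc]
    refine Real.rpow_nonneg ?_ _
    have hσ : (0 : ℝ) < θ.2.2 := θ.2.2.2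
    have : 1 + θ.1 * ((y.toReal - θ.2.1) / θ.2.2) =
      (θ.2.2 + θ.1 * (y.toReal - θ.2.1)) / θ.2.2 := by field_simp
    rw [this]
    exact (div_pos h4 hσ).le

theorem gevQuantile_lt_iff_of_mem_Ioo {p : ℝ} (h0 : 0 < p) (h1 : p < 1) (θ : GEVParam) (y : EReal) :
    gevQuantile p θ < y ↔ p < gevCDF θ y := by
  rw [gevQuantile_eq_coe h0 h1]
  induction y with
  | bot => simp [h0.le]
  | top => exact iff_of_true (EReal.coe_lt_top _) (by simpa using h1)
  | coe z => rw [gevCDF_coe, EReal.coe_lt_coe_iff, (cmp_gevCDFReal h0 h1 θ z).1]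

theorem lt_gevQuantile_iff_of_mem_Ioo {p : ℝ} (h0 : 0 < p) (h1 : p < 1) (θ : GEVParam) (y : EReal) :
    y < gevQuantile p θ ↔ gevCDF θ y < p := by
  rw [gevQuantile_eq_coe h0 h1]
  induction y with
  | bot => exact iff_of_true (EReal.bot_lt_coe _) (by simpa using h0)
  | top => simp [h1.le]
  | coe z => rw [gevCDF_coe, EReal.coe_lt_coe_iff, (cmp_gevCDFReal h0 h1 θ z).2]

theorem gevQuantile_zero_lt_iff (θ : GEVParam) (y : EReal) :
    gevQuantile 0 θ < y ↔ 0 < gevCDF θ y := by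
  induction y with
  | bot => simp
  | top =>
    rcases le_or_gt θ.1 0 with h | h
    · simp [gevQuantile_of_nonpos_nonpos le_rfl h]
    · rw [gevQuantile_of_nonpos_pos le_rfl h]
      exact iff_of_true (EReal.coe_lt_top _) (by simp)
  | coe z =>
    have hσ : (0 : ℝ) < θ.2.2 := θ.2.2.2
    rw [gevCDF_coe]
    unfold gevCDFReal
    dsimp only
    rcases le_or_gt θ.1 0 with h | h
    · rw [gevQuantile_of_nonpos_nonpos le_rfl h]
      refine iff_of_true (by simp) ?_
      split_ifs <;> first | positivity | linarith
    · rw [gevQuantile_of_nonpos_pos le_rfl h, EReal.coe_lt_coe_iff, if_neg h.ne', if_pos h]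
      have : θ.2.1 - θ.2.2 / θ.1 < z ↔ 0 < θ.2.2 + θ.1 * (z - θ.2.1) := by
        rw [sub_lt_comm, lt_div_iff₀ h]
        constructor <;> intro <;> linarith
      rw [this]
      split_ifs with h2
      · exact iff_of_true h2 (Real.exp_pos _)
      · simp [h2]

theorem gevQuantile_lt_iff {p : ℝ} (h0 : 0 ≤ p) (h1 : p ≤ 1) (θ : GEVParam) (y : EReal) :
    gevQuantile p θ < y ↔ p < gevCDF θ y := by
  rcases h0.eq_or_lt with rfl | h0
  · exact gevQuantile_zero_lt_iff θ y
  · rcases h1.eq_or_lt with rfl | h1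
    · simp [gevQuantile_one, (gevCDF_le_one θ y)]
    · exact gevQuantile_lt_iff_of_mem_Ioo h0 h1 θ y

theorem gevCDF_gevQuantile {p : ℝ} (h0 : 0 ≤ p) (h1 : p ≤ 1) (θ : GEVParam) :
    gevCDF θ (gevQuantile p θ) = p := by
  have h : ¬ p < gevCDF θ (gevQuantile p θ) := by
    rw [← gevQuantile_lt_iff h0 h1]
    exact lt_irrefl _
  rcases h0.eq_or_lt with rfl | h0
  · exact le_antisymm (not_lt.mp h) (gevCDF_nonneg _ _)
  · rcases h1.eq_or_lt with rfl | h1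
    · simp [gevQuantile_one]
    · refine le_antisymm (not_lt.mp h) (not_lt.mp ?_)
      rw [← lt_gevQuantile_iff_of_mem_Ioo h0 h1]
      exact lt_irrefl _

theorem gevQuantile_gevCDF {θ : GEVParam} {y : EReal} (h0 : 0 < gevCDF θ y)
    (h1 : gevCDF θ y < 1) : gevQuantile (gevCDF θ y) θ = y := by
  refine le_antisymm (not_lt.mp ?_) (not_lt.mp ?_)
  · rw [lt_gevQuantile_iff_of_mem_Ioo h0 h1]
    exact lt_irrefl _
  · rw [gevQuantile_lt_iff_of_mem_Ioo h0 h1]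
    exact lt_irrefl _

theorem monotone_gevCDF (θ : GEVParam) : Monotone (gevCDF θ) := by
  intro y z hyz
  by_contra h
  obtain ⟨p, h1, h2⟩ := exists_between (not_le.mp h)
  have hp0 := (gevCDF_nonneg θ z).trans_lt h1
  have hp1 := h2.trans_le (gevCDF_le_one θ y)
  rw [← gevQuantile_lt_iff_of_mem_Ioo hp0 hp1] at h2
  exact absurd ((gevQuantile_lt_iff_of_mem_Ioo hp0 hp1 _ _).mp (h2.trans_le hyz)) h1.not_gt

theorem monotone_gevQuantile (θ : GEVParam) {p q : ℝ} (h0 : 0 ≤ p) (hpq : p ≤ q) (h1 : q ≤ 1) :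
    gevQuantile p θ ≤ gevQuantile q θ := by
  by_contra h
  rw [not_le, gevQuantile_lt_iff (h0.trans hpq) h1, gevCDF_gevQuantile h0 (hpq.trans h1)] at h
  exact absurd h hpq.not_gt

/-- Levels outside `(0, 1)` impose no condition on a `[0, 1]`-valued function, so the quantile is
needed only at levels where it is real and continuous in `θ`. -/
theorem continuous_of_isOpen_setOf_lt_Ioo {X : Type*} [TopologicalSpace X] {f : X → ℝ}
    (hf : ∀ x, f x ∈ Set.Icc (0 : ℝ) 1)
    (h : ∀ p, 0 < p → p < 1 → IsOpen {x | p < f x} ∧ IsOpen {x | f x < p}) : Continuous f := by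
  rw [continuous_iff_lower_upperSemicontinuous]
  constructor
  · intro x y hy
    rcases lt_or_ge y 0 with hy0 | hy0
    · exact Filter.Eventually.of_forall fun t => hy0.trans_le (hf t).1
    · obtain ⟨p, h1, h2⟩ := exists_between hy
      filter_upwards [(h p (hy0.trans_lt h1) (h2.trans_le (hf x).2)).1.mem_nhds h2] with t ht
      exact h1.trans ht
  · intro x y hy
    rcases lt_or_ge 1 y with hy1 | hy1
    · exact Filter.Eventually.of_forall fun t => (hf t).2.trans_lt hy1
    · obtain ⟨p, h1, h2⟩ := exists_between hy
      filter_upwards [(h p ((hf x).1.trans_lt h1) (h2.trans_le hy1)).2.mem_nhds h1] with t ht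
      exact ht.trans h2

theorem continuous_gevQuantile_left {p : ℝ} (h0 : 0 < p) (h1 : p < 1) :
    Continuous (gevQuantile p) := by
  have : gevQuantile p = fun θ : GEVParam =>
      ((θ.2.1 + θ.2.2 * boxCox (-1 / Real.log p) θ.1 : ℝ) : EReal) :=
    funext fun θ => gevQuantile_eq_coe h0 h1 θ
  rw [this]
  have := continuous_boxCox (neg_one_div_log_pos h0 h1)
  exact continuous_coe_real_ereal.comp (by fun_prop)

theorem continuous_gevCDF (θ : GEVParam) : Continuous (gevCDF θ) := by
  refine continuous_of_isOpen_setOf_lt_Ioo (fun y => ⟨gevCDF_nonneg θ y, gevCDF_le_one θ y⟩) ?_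
  intro p h0 h1
  simp only [← gevQuantile_lt_iff_of_mem_Ioo h0 h1, ← lt_gevQuantile_iff_of_mem_Ioo h0 h1]
  exact ⟨isOpen_Ioi, isOpen_Iio⟩

theorem continuous_gevCDF_left (y : EReal) : Continuous fun θ : GEVParam => gevCDF θ y := by
  refine continuous_of_isOpen_setOf_lt_Ioo (fun θ => ⟨gevCDF_nonneg θ y, gevCDF_le_one θ y⟩) ?_
  intro p h0 h1
  simp only [← gevQuantile_lt_iff_of_mem_Ioo h0 h1, ← lt_gevQuantile_iff_of_mem_Ioo h0 h1]
  have := continuous_gevQuantile_left h0 h1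
  exact ⟨isOpen_lt this continuous_const, isOpen_lt continuous_const this⟩

/-- The lower endpoint is lower semicontinuous in `θ`: multiplying by `γ > 0` clears the denominator
and leaves strict polynomial inequalities. It is what allows passage from a dense set of points to
all points. -/
theorem isOpen_setOf_lt_gevQuantile_zero (z : ℝ) :
    IsOpen {θ : GEVParam | (z : EReal) < gevQuantile 0 θ} := by
  have : {θ : GEVParam | (z : EReal) < gevQuantile 0 θ} =
      {θ : GEVParam | 0 < θ.1 ∧ z * θ.1 < θ.2.1 * θ.1 - θ.2.2} := by
    ext θ
    simp only [Set.mem_ofPred_eq]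
    rcases le_or_gt θ.1 0 with h | h
    · simp [gevQuantile_of_nonpos_nonpos le_rfl h, h.not_gt]
    · rw [gevQuantile_of_nonpos_pos le_rfl h, EReal.coe_lt_coe_iff, ← mul_lt_mul_iff_left₀ h,
        sub_mul, div_mul_cancel₀ _ h.ne']
      simp [h]
  rw [this]
  exact (isOpen_lt continuous_const continuous_fst).inter
    (isOpen_lt (f := fun θ : GEVParam => z * θ.1) (g := fun θ : GEVParam => θ.2.1 * θ.1 - θ.2.2)
      (by fun_prop) (by fun_prop))

theorem negInvLog_eq (p : ℝ) : negInvLog p = gevQuantile p unitFrechetParam := by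
  unfold negInvLog gevQuantile unitFrechetParam
  simp

theorem unitFrechetCDF_lt_one (x : ℝ) : unitFrechetCDF x < 1 := by
  rw [unitFrechetCDF, gevCDF_coe]
  unfold gevCDFReal unitFrechetParam
  simp only [one_ne_zero, if_false, zero_lt_one, if_true]
  split_ifs with h
  · refine Real.exp_lt_one_iff.mpr (neg_neg_of_pos (Real.rpow_pos_of_pos ?_ _))
    simpa using h
  · norm_num

/-- Multiplicative constant of the max-stability relation of the GEV distribution. -/
noncomputable def gevScale (n : ℕ) (θ : GEVParam) : ℝ := (n : ℝ) ^ θ.1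

/-- Additive constant of the max-stability relation of the GEV distribution. -/
noncomputable def gevShift (n : ℕ) (θ : GEVParam) : ℝ :=
  θ.2.1 * (1 - (n : ℝ) ^ θ.1) + θ.2.2 * boxCox n θ.1

theorem gevScale_pos {n : ℕ} (hn : 1 ≤ n) (θ : GEVParam) : 0 < gevScale n θ :=
  Real.rpow_pos_of_pos (by exact_mod_cast hn) _

theorem continuous_gevScale {n : ℕ} (hn : 1 ≤ n) : Continuous (gevScale n) :=
  continuous_const.rpow continuous_fst fun _ => Or.inl (by positivity)

theorem continuous_gevShift {n : ℕ} (hn : 1 ≤ n) : Continuous (gevShift n) := by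
  have h1 : Continuous fun θ : GEVParam => (n : ℝ) ^ θ.1 := continuous_gevScale hn
  have h2 : Continuous (boxCox n) := continuous_boxCox (by exact_mod_cast hn)
  unfold gevShift
  fun_prop

theorem boxCox_mul {n w : ℝ} (hn : 0 < n) (hw : 0 < w) (γ : ℝ) :
    boxCox (n * w) γ = n ^ γ * boxCox w γ + boxCox n γ := by
  by_cases hγ : γ = 0
  · subst hγ
    rw [boxCox_zero hn, boxCox_zero hw, boxCox_zero (mul_pos hn hw),
      Real.log_mul hn.ne' hw.ne', Real.rpow_zero]
    ring
  · rw [boxCox_of_ne _ hγ, boxCox_of_ne _ hγ, boxCox_of_ne _ hγ, Real.mul_rpow hn.le hw.le]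
    field_simp
    ring

/-- The GEV distributions are max-stable. -/
theorem gevQuantile_eq_gevQuantile_pow {n : ℕ} (hn : 1 ≤ n) {p : ℝ} (h0 : 0 ≤ p) (h1 : p ≤ 1)
    (θ : GEVParam) :
    gevQuantile p θ =
      (gevScale n θ : EReal) * gevQuantile (p ^ n) θ + (gevShift n θ : EReal) := by
  have hn0 : n ≠ 0 := by lia
  have hn' : (0 : ℝ) < n := by exact_mod_cast hn
  rcases h0.eq_or_lt with rfl | h0
  · rw [zero_pow hn0]
    rcases le_or_gt θ.1 0 with h | h
    · rw [gevQuantile_of_nonpos_nonpos le_rfl h, EReal.coe_mul_bot_of_pos (gevScale_pos hn θ),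
        EReal.bot_add]
    · rw [gevQuantile_of_nonpos_pos le_rfl h]
      norm_cast
      rw [gevShift, gevScale, boxCox_of_ne _ h.ne']
      field_simp
      ring
  · rcases h1.eq_or_lt with rfl | h1
    · rw [one_pow, gevQuantile_one, EReal.coe_mul_top_of_pos (gevScale_pos hn θ),
        EReal.top_add_coe]
    · rw [gevQuantile_eq_coe h0 h1, gevQuantile_eq_coe (pow_pos h0 n) (pow_lt_one₀ h0.le h1 hn0)]
      rw [← EReal.coe_mul, ← EReal.coe_add, EReal.coe_eq_coe_iff]
      -- Raising `p` to the power `n` divides `w` by `n`; the functional equation `boxCox_mul` turns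
      -- this scaling into an affine map.
      have hw : -1 / Real.log p = n * (-1 / Real.log (p ^ n)) := by
        have := (Real.log_neg h0 h1).ne
        rw [Real.log_pow]
        field_simp
      rw [hw, boxCox_mul hn' (neg_one_div_log_pos (pow_pos h0 n) (pow_lt_one₀ h0.le h1 hn0)), gevShift,
        gevScale]
      ring

theorem negInvLog_eq_mul_negInvLog_pow {n : ℕ} (hn : 1 ≤ n) {p : ℝ} (h0 : 0 ≤ p) (h1 : p ≤ 1) :
    negInvLog p = ((n : ℝ) : EReal) * negInvLog (p ^ n) := by
  rw [negInvLog_eq, negInvLog_eq, gevQuantile_eq_gevQuantile_pow hn h0 h1]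
  have h2 : gevScale n unitFrechetParam = n := by simp [gevScale, unitFrechetParam]
  have h3 : gevShift n unitFrechetParam = 0 := by
    simp [gevShift, unitFrechetParam, boxCox_of_ne _ one_ne_zero]
  rw [h2, h3]
  simp

/-- The transformation of `[-∞, ∞]` carrying the distribution with parameter `θ₁` to the one with
parameter `θ₂`. -/
noncomputable def gevTransform (θ₁ θ₂ : GEVParam) (y : EReal) : EReal :=
  gevQuantile (gevCDF θ₁ y) θ₂

/-- By the Galois relation, `g s y < α` means `F(y; θ₁ s) < F(α; θ₂ s)`. This avoids any continuity
of the quantile at the levels `0` and `1`. -/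
theorem isUSCFamily_gevTransform {D : Type*} [TopologicalSpace D] {θ₁ θ₂ : D → GEVParam}
    (h₁ : Continuous θ₁) (h₂ : Continuous θ₂) :
    USC.IsUSCFamily fun s => gevTransform (θ₁ s) (θ₂ s) where
  map_top s := by simp [gevTransform, gevQuantile_one]
  mono s y z h := monotone_gevQuantile _ (gevCDF_nonneg _ _) (monotone_gevCDF _ h)
    (gevCDF_le_one _ _)
  isOpen_left y α := by
    simp only [gevTransform, gevQuantile_lt_iff (gevCDF_nonneg _ _) (gevCDF_le_one _ _)]
    exact isOpen_lt ((continuous_gevCDF_left y).comp h₁) ((continuous_gevCDF_left α).comp h₂)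
  isOpen_right s α := by
    simp only [gevTransform, gevQuantile_lt_iff (gevCDF_nonneg _ _) (gevCDF_le_one _ _)]
    exact isOpen_lt (continuous_gevCDF _) continuous_const

theorem isUSCFamily_affine {D : Type*} [TopologicalSpace D] {a b : D → ℝ} (ha : Continuous a)
    (hb : Continuous b) (hpos : ∀ s, 0 < a s) :
    USC.IsUSCFamily fun s y => (a s : EReal) * y + (b s : EReal) where
  map_top s := by simp [EReal.coe_mul_top_of_pos (hpos s)]
  mono s y z h := by
    have : (0 : EReal) ≤ a s := by exact_mod_cast (hpos s).le
    dsimp only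
    gcongr
  isOpen_left y α := by
    induction y with
    | bot => simp [EReal.coe_mul_bot_of_pos (hpos _)]
    | top => simp [EReal.coe_mul_top_of_pos (hpos _)]
    | coe z =>
      norm_cast
      exact isOpen_lt (by fun_prop) continuous_const
  isOpen_right s α := by
    have : {y : EReal | (a s : EReal) * y + (b s : EReal) < (α : EReal)} =
        Set.Iio (((α - b s) / a s : ℝ) : EReal) := by
      ext y
      simp only [Set.mem_ofPred_eq, Set.mem_Iio]
      induction y with
      | bot => simp [EReal.coe_mul_bot_of_pos (hpos _)]
      | top => simp [EReal.coe_mul_top_of_pos (hpos _)]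
      | coe z =>
        norm_cast
        rw [lt_div_iff₀ (hpos s), lt_sub_iff_add_lt, mul_comm]
    rw [this]
    exact isOpen_Iio

end GEV

/-! ### Probability integral transform of the margins. -/

section Margins

variable {D : Type*} [TopologicalSpace D] {Ω : Type*} [MeasurableSpace Ω] {P : Measure Ω}
  {ξ : Ω → USC D} {θ : D → GEVParam}

theorem measure_gevCDF_le (hmargins : HasGEVMargins P ξ θ) (s : D) {p : ℝ} (h0 : 0 < p)
    (h1 : p < 1) : P {ω | gevCDF (θ s) (ξ ω s) ≤ p} = ENNReal.ofReal p := by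
  have : {ω | gevCDF (θ s) (ξ ω s) ≤ p} = {ω | ξ ω s ≤ gevQuantile p (θ s)} := by
    ext ω
    simp only [Set.mem_ofPred_eq, ← not_lt, gevQuantile_lt_iff h0.le h1.le]
  rw [this, gevQuantile_eq_coe h0 h1, hmargins, ← gevQuantile_eq_coe h0 h1,
    gevCDF_gevQuantile h0.le h1.le]

/-- The margins have no mass where `F` vanishes: this event lies in `{F ≤ p}`, of probability `p`,
for every small `p > 0`. -/
theorem measure_gevCDF_le_zero (hmargins : HasGEVMargins P ξ θ) (s : D) :
    P {ω | gevCDF (θ s) (ξ ω s) ≤ 0} = 0 := by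
  refine le_antisymm (ENNReal.le_of_forall_pos_le_add fun ε hε _ => ?_) zero_le
  rw [zero_add]
  have hp : 0 < min (ε : ℝ) (1 / 2) := lt_min (by exact_mod_cast hε) (by norm_num)
  calc P {ω | gevCDF (θ s) (ξ ω s) ≤ 0}
      ≤ P {ω | gevCDF (θ s) (ξ ω s) ≤ min (ε : ℝ) (1 / 2)} :=
        measure_mono fun ω hω => le_trans hω hp.le
    _ = ENNReal.ofReal (min (ε : ℝ) (1 / 2)) :=
        measure_gevCDF_le hmargins s hp ((min_le_right _ _).trans_lt (by norm_num))
    _ ≤ ENNReal.ofReal ε := ENNReal.ofReal_le_ofReal (min_le_left _ _)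
    _ = ε := ENNReal.ofReal_coe_nnreal

theorem measure_negInvLog_le (hmargins : HasGEVMargins P ξ θ) (s : D) (x : ℝ) :
    P {ω | negInvLog (gevCDF (θ s) (ξ ω s)) ≤ (x : EReal)} =
      ENNReal.ofReal (unitFrechetCDF x) := by
  have hx1 := unitFrechetCDF_lt_one x
  simp only [negInvLog_eq]
  rcases (gevCDF_nonneg unitFrechetParam x).eq_or_lt with h0 | h0
  · rw [unitFrechetCDF, ← h0, ENNReal.ofReal_zero]
    refine measure_mono_null (fun ω hω => ?_) (measure_gevCDF_le_zero hmargins s)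
    by_contra hc
    -- Here `Φ(x) = 0`, so every interior level has Fréchet quantile above `x`.
    obtain ⟨p, hp1, hp2⟩ := exists_between (not_le.mp (show ¬ gevCDF (θ s) (ξ ω s) ≤ 0 from hc))
    have hp3 := hp2.trans_le (gevCDF_le_one _ _)
    have h2 : (x : EReal) < gevQuantile p unitFrechetParam := by
      rw [lt_gevQuantile_iff_of_mem_Ioo hp1 hp3, ← h0]
      exact hp1
    exact absurd (h2.trans_le (monotone_gevQuantile _ hp1.le hp2.le (gevCDF_le_one _ _)))
      (not_lt.mpr hω)
  · rw [unitFrechetCDF, ← measure_gevCDF_le hmargins s h0 hx1]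
    congr 1
    ext ω
    simp only [Set.mem_ofPred_eq]
    constructor
    · intro h
      have := monotone_gevCDF unitFrechetParam h
      rwa [gevCDF_gevQuantile (gevCDF_nonneg _ _) (gevCDF_le_one _ _)] at this
    · intro h
      have := monotone_gevQuantile unitFrechetParam (gevCDF_nonneg _ _) h hx1.le
      rwa [gevQuantile_gevCDF h0 hx1] at this

end Margins

/-! ### Laws of maxima and norming constants. -/

section Laws

variable {D : Type*} [TopologicalSpace D] [LocallyCompactSpace D]

theorem USC.measurableSet_setOf_apply_le (s : D) (r : EReal) :
    MeasurableSet {x : USC D | x s ≤ r} :=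
  measurableSet_Iic.preimage (USC.measurable_eval s)

variable [SecondCountableTopology D] [T2Space D]

theorem map_max_pi_apply_le (L : Measure (USC D)) [IsProbabilityMeasure L] (n : ℕ) (s : D)
    (r : EReal) :
    (Measure.pi fun _ : Fin n => L).map USC.max {x | x s ≤ r} = L {x | x s ≤ r} ^ n := by
  rw [Measure.map_apply USC.measurable_max (USC.measurableSet_setOf_apply_le s r)]
  have : USC.max ⁻¹' {x : USC D | x s ≤ r} =
      Set.univ.pi fun _ : Fin n => {x : USC D | x s ≤ r} := by
    ext x
    simp [USC.max]
  rw [this, Measure.pi_pi]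
  simp

theorem map_max_pi_map_comp (L : Measure (USC D)) [IsProbabilityMeasure L] {n : ℕ} (hn : 1 ≤ n)
    (g : D → EReal → EReal) (hg : USC.IsUSCFamily g) :
    (Measure.pi fun _ : Fin n => L.map (USC.comp g hg)).map USC.max =
      ((Measure.pi fun _ : Fin n => L).map USC.max).map (USC.comp g hg) := by
  have hm := USC.measurable_comp g hg
  have : Nonempty (Fin n) := ⟨⟨0, hn⟩⟩
  have := Measure.isProbabilityMeasure_map (μ := L) hm.aemeasurable
  rw [← Measure.pi_map_pi (fun _ => hm.aemeasurable),
    Measure.map_map USC.measurable_max (by fun_prop), Measure.map_map hm USC.measurable_max]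
  congr 1
  ext1 x
  exact (USC.comp_max g hg x).symm

/-- Max-stability in terms of the law of the process. -/
theorem maxStable_iff {D : Type} [TopologicalSpace D] [LocallyCompactSpace D]
    [SecondCountableTopology D] [T2Space D] {Ω : Type*} [MeasurableSpace Ω] {P : Measure Ω}
    [IsProbabilityMeasure P] {ξ : Ω → USC D} (hξ : Measurable ξ) :
    MaxStable P ξ ↔ ∀ n : ℕ, 1 ≤ n → ∃ (a b : D → ℝ) (η : Ω → USC D), (∀ s, 0 < a s) ∧
      Measurable η ∧ (∀ ω s, η ω s = (a s : EReal) * ξ ω s + (b s : EReal)) ∧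
      (Measure.pi fun _ : Fin n => P.map ξ).map USC.max = P.map η := by
  have := Measure.isProbabilityMeasure_map (μ := P) hξ.aemeasurable
  refine forall₂_congr fun n hn => exists_congr fun a => exists_congr fun b =>
    exists_congr fun η => and_congr_right fun _ => and_congr_right fun _ =>
    and_congr_right fun _ => ⟨fun h => ?_, fun h => ?_⟩
  -- The coordinates on the product space are iid copies; this space lies in `Type` because `D`
  -- does.
  · exact h (Fin n → USC D) _ (Measure.pi fun _ => P.map ξ) inferInstance (fun i x => x i)
      (fun i => measurable_pi_apply i) (iIndepFun_pi (X := fun _ x => x) fun _ => aemeasurable_id)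
      fun i => (measurePreserving_eval (fun _ : Fin n => P.map ξ) i).map_eq
  · intro Ω' _ P' _ ζ hζ hind hlaw
    have h1 := hind.map_fun_eq_pi_map fun i => (hζ i).aemeasurable
    simp only [hlaw] at h1
    rw [← h, ← h1, Measure.map_map USC.measurable_max (by fun_prop)]
    rfl

theorem EReal.coe_mul_add_coe_le_iff {a : ℝ} (ha : 0 < a) (b y : ℝ) (x : EReal) :
    (a : EReal) * x + (b : EReal) ≤ ((a * y + b : ℝ) : EReal) ↔ x ≤ (y : EReal) := by
  induction x with
  | bot => simp [EReal.coe_mul_bot_of_pos ha]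
  | top => simp [EReal.coe_mul_top_of_pos ha, -EReal.coe_add]
  | coe z =>
    norm_cast
    simp [ha]

variable {Ω : Type*} [MeasurableSpace Ω] {P : Measure Ω} [IsProbabilityMeasure P]
  {ξ : Ω → USC D} {θ : D → GEVParam}

/-- The relation between the normalizing functions and the margins of a max-stable process. -/
theorem gevCDF_pow_eq (hξ : Measurable ξ) (hmargins : HasGEVMargins P ξ θ) {n : ℕ} (hn : 1 ≤ n)
    {a b : D → ℝ} {η : Ω → USC D} (ha : ∀ s, 0 < a s) (hη : Measurable η)
    (h : ∀ ω s, η ω s = (a s : EReal) * ξ ω s + (b s : EReal))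
    (hlaw : (Measure.pi fun _ : Fin n => P.map ξ).map USC.max = P.map η) (s : D) (y : EReal) :
    gevCDF (θ s) ((a s : EReal) * y + (b s : EReal)) ^ n = gevCDF (θ s) y := by
  induction y with
  | bot => simp [EReal.coe_mul_bot_of_pos (ha s), show n ≠ 0 by lia]
  | top => simp [EReal.coe_mul_top_of_pos (ha s)]
  | coe y =>
    have := Measure.isProbabilityMeasure_map (μ := P) hξ.aemeasurable
    have key := map_max_pi_apply_le (P.map ξ) n s ((a s * y + b s : ℝ) : EReal)
    rw [hlaw, Measure.map_apply hη (USC.measurableSet_setOf_apply_le s _),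
      Measure.map_apply hξ (USC.measurableSet_setOf_apply_le s _)] at key
    simp only [Set.preimage_ofPred_eq, h, EReal.coe_mul_add_coe_le_iff (ha s)] at key
    rw [hmargins, hmargins, ← ENNReal.ofReal_pow (gevCDF_nonneg _ _),
      ENNReal.ofReal_eq_ofReal_iff (gevCDF_nonneg _ _) (pow_nonneg (gevCDF_nonneg _ _) _)] at key
    rw [key]
    norm_cast

end Laws

/-! ### Almost sure inversion at all points simultaneously. -/

section Trajectories

variable {D : Type*} [TopologicalSpace D] [LocallyCompactSpace D] [SecondCountableTopology D]
  {Ω : Type*} [MeasurableSpace Ω] {P : Measure Ω} {ξ : Ω → USC D} {θ : D → GEVParam}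

/-- Almost surely, all trajectories stay within the supports of the margins, so that the
probability integral transform can be undone. -/
theorem ae_forall_gevQuantile_gevCDF (hθ : Continuous θ) (hmargins : HasGEVMargins P ξ θ)
    (hsup : ∀ K : Set D, IsCompact K →
      ∀ᵐ ω ∂P, sSup ((fun s => gevCDF (θ s) (ξ ω s)) '' K) < 1) :
    ∀ᵐ ω ∂P, ∀ s, gevQuantile (gevCDF (θ s) (ξ ω s)) (θ s) = ξ ω s := by
  -- A countable compact exhaustion yields one null set outside which `F < 1` at every point.
  have h1 : ∀ᵐ ω ∂P, ∀ k, sSup ((fun s => gevCDF (θ s) (ξ ω s)) '' compactCovering D k) < 1 :=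
    ae_all_iff.mpr fun k => hsup _ (isCompact_compactCovering D k)
  obtain ⟨S, hS, hSd⟩ := exists_countable_dense D
  have h2 : ∀ᵐ ω ∂P, ∀ s ∈ S, 0 < gevCDF (θ s) (ξ ω s) := by
    rw [ae_ball_iff hS]
    intro s _
    rw [ae_iff]
    simpa only [not_lt] using measure_gevCDF_le_zero hmargins s
  filter_upwards [h1, h2] with ω h1 h2 s
  obtain ⟨k, hk⟩ := Set.mem_iUnion.mp ((iUnion_compactCovering D).symm ▸ Set.mem_univ s)
  have hlt : gevCDF (θ s) (ξ ω s) < 1 := lt_of_le_of_lt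
    (le_csSup ⟨1, by rintro _ ⟨t, _, rfl⟩; exact gevCDF_le_one _ _⟩ 
      (Set.mem_image_of_mem (fun s => gevCDF (θ s) (ξ ω s)) hk))
    (h1 k)
  rcases (gevCDF_nonneg (θ s) (ξ ω s)).eq_or_lt with h0 | h0
  · rw [← h0]
    refine le_antisymm (not_lt.mp fun hc => ?_) (not_lt.mp ?_)
    -- If `ξ(s)` were below the lower endpoint, some `z` would separate them on a neighbourhood,
    -- hence at a point of the dense set, where `F > 0`.
    · obtain ⟨z, hz1, hz2⟩ := EReal.lt_iff_exists_real_btwn.mp hc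
      obtain ⟨t, ⟨ht1, ht2⟩, htS⟩ := mem_closure_iff_nhds.mp (hSd s) _
        (((ξ ω).usc s z hz1).and
          (((isOpen_setOf_lt_gevQuantile_zero z).preimage hθ).mem_nhds hz2))
      have := (gevQuantile_zero_lt_iff _ _).mpr (h2 t htS)
      exact absurd (this.trans (ht1.trans ht2)) (lt_irrefl _)
    · rw [gevQuantile_zero_lt_iff, ← h0]
      exact lt_irrefl _
  · exact gevQuantile_gevCDF h0 hlt

end Trajectories

/-! ### Normalization on the Fréchet scale. -/

section Transforms

theorem gevTransform_unitFrechet (θ : GEVParam) (y : EReal) :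
    gevTransform θ unitFrechetParam y = negInvLog (gevCDF θ y) :=
  (negInvLog_eq _).symm

theorem unitFrechetCDF_negInvLog {p : ℝ} (h0 : 0 ≤ p) (h1 : p ≤ 1) :
    unitFrechetCDF (negInvLog p) = p := by
  rw [negInvLog_eq]
  exact gevCDF_gevQuantile h0 h1 _

theorem gevQuantile_unitFrechetCDF_mul {n : ℕ} (hn : 1 ≤ n) {p : ℝ} (h0 : 0 ≤ p) (h1 : p ≤ 1)
    (θ : GEVParam) :
    gevQuantile (unitFrechetCDF (((n : ℝ) : EReal) * negInvLog p)) θ =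
      (gevScale n θ : EReal) * gevQuantile p θ + (gevShift n θ : EReal) := by
  have hn0 : n ≠ 0 := by lia
  -- The `n`-th root `q` of `p` satisfies `-1/log q = n · (-1/log p)`, so both sides are the
  -- quantile at `q`.
  obtain ⟨q, hq0, hq1, rfl⟩ : ∃ q : ℝ, 0 ≤ q ∧ q ≤ 1 ∧ q ^ n = p :=
    ⟨p ^ (n⁻¹ : ℝ), Real.rpow_nonneg h0 _, Real.rpow_le_one h0 h1 (by positivity),
      Real.rpow_inv_natCast_pow h0 hn0⟩
  rw [← negInvLog_eq_mul_negInvLog_pow hn hq0 hq1, unitFrechetCDF_negInvLog hq0 hq1,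
    gevQuantile_eq_gevQuantile_pow hn hq0 hq1]

/-- Inverting `Φ` at `y > 0` yields `a y + b = n y`; two values of `y` determine both constants. -/
theorem eq_of_unitFrechetCDF_pow_eq {n : ℕ} (hn : 1 ≤ n) {a b : ℝ}
    (h : ∀ y : EReal, unitFrechetCDF ((a : EReal) * y + (b : EReal)) ^ n = unitFrechetCDF y) :
    a = n ∧ b = 0 := by
  have hn0 : n ≠ 0 := by lia
  have key : ∀ y : ℝ, 0 < y → a * y + b = n * y := by
    intro y hy
    have h0 : 0 < gevCDF unitFrechetParam y := by
      rw [← gevQuantile_zero_lt_iff, ← negInvLog_eq]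
      simpa [negInvLog] using hy
    have h1 : gevCDF unitFrechetParam y < 1 := unitFrechetCDF_lt_one y
    have hu := h y
    have hu0 := gevCDF_nonneg unitFrechetParam ((a : EReal) * y + (b : EReal))
    have hu1 := gevCDF_le_one unitFrechetParam ((a : EReal) * y + (b : EReal))
    unfold unitFrechetCDF at hu
    have h2 := negInvLog_eq_mul_negInvLog_pow hn hu0 hu1
    rw [hu] at h2
    rw [negInvLog_eq, negInvLog_eq, gevQuantile_gevCDF h0 h1, gevQuantile_gevCDF] at h2
    · exact_mod_cast h2
    · refine hu0.lt_of_ne fun hc => ?_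
      rw [← hc, zero_pow hn0] at hu
      exact h0.ne hu
    · refine hu1.lt_of_ne fun hc => ?_
      rw [hc, one_pow] at hu
      exact h1.ne hu.symm
  have h1 := key 1 one_pos
  have h2 := key 2 two_pos
  constructor <;> linarith

end Transforms

/-! ### The proposition. -/

theorem mainTheorem2 {d : ℕ} (D : Set (EuclideanSpace ℝ (Fin d))) [LocallyCompactSpace D]
    {Ω : Type*} [MeasurableSpace Ω] (P : Measure Ω) [IsProbabilityMeasure P]
    (θ : D → GEVParam) (hθ : Continuous θ)
    (ξ : Ω → USC D) (hξ : Measurable ξ) (hmargins : HasGEVMargins P ξ θ)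
    (hsup : ∀ K : Set D, IsCompact K →
      ∀ᵐ ω ∂P, sSup ((fun s => gevCDF (θ s) (ξ ω s)) '' K) < 1) :
    ∃ ξstar ξtilde : Ω → USC D,
      Measurable ξstar ∧ (∀ ω s, ξstar ω s = negInvLog (gevCDF (θ s) (ξ ω s))) ∧
      Measurable ξtilde ∧
      (∀ ω s, ξtilde ω s = gevQuantile (unitFrechetCDF (ξstar ω s)) (θ s)) ∧
      (∀ᵐ ω ∂P, ξ ω = ξtilde ω) ∧
      (MaxStable P ξ ↔ SimpleMaxStable P ξstar) := by
  have hT := isUSCFamily_gevTransform hθ (continuous_const (y := unitFrechetParam))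
  have hT' := isUSCFamily_gevTransform (continuous_const (y := unitFrechetParam)) hθ
  have mT := USC.measurable_comp _ hT
  have mT' := USC.measurable_comp _ hT'
  set T := USC.comp _ hT with hTdef
  set T' := USC.comp _ hT' with hTdef'
  have hstar : ∀ ω s, T (ξ ω) s = negInvLog (gevCDF (θ s) (ξ ω s)) := fun ω s =>
    gevTransform_unitFrechet _ _
  have hcdf : ∀ ω s, unitFrechetCDF (T (ξ ω) s) = gevCDF (θ s) (ξ ω s) := fun ω s => by
    rw [hstar, unitFrechetCDF_negInvLog (gevCDF_nonneg _ _) (gevCDF_le_one _ _)]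
  have hae := ae_forall_gevQuantile_gevCDF hθ hmargins hsup
  have hξT : ξ =ᵐ[P] T' ∘ T ∘ ξ := by
    filter_upwards [hae] with ω hω
    refine USC.ext_of_forall fun s => ?_
    change _ = gevQuantile (unitFrechetCDF (T (ξ ω) s)) (θ s)
    rw [hcdf, hω]
  have hmT : Measurable (T ∘ ξ) := mT.comp hξ
  have hmargins' : HasGEVMargins P (T ∘ ξ) fun _ => unitFrechetParam := fun s x => by
    simp only [Function.comp_apply, hstar]
    exact measure_negInvLog_le hmargins s x
  have := Measure.isProbabilityMeasure_map (μ := P) hξ.aemeasurable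
  have := Measure.isProbabilityMeasure_map (μ := P) hmT.aemeasurable
  refine ⟨T ∘ ξ, T' ∘ T ∘ ξ, hmT, hstar, mT'.comp hmT, fun ω s => rfl, hξT, ?_⟩
  rw [SimpleMaxStable, maxStable_iff hξ, maxStable_iff hmT]
  constructor
  · refine fun h => ⟨fun n hn => ?_, hmargins'⟩
    obtain ⟨a, b, η, ha, hη, hη', hlaw⟩ := h n hn
    refine ⟨fun _ => n, fun _ => 0, T ∘ η, fun _ => Nat.cast_pos.mpr hn, mT.comp hη, ?_, ?_⟩
    · intro ω s
      -- `F(η)^n = F(ξ)` gives `T η = n · T ξ` for every `ω`, without any continuity of `a` and `b`.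
      have hpow := gevCDF_pow_eq hξ hmargins hn ha hη hη' hlaw s (ξ ω s)
      rw [← hη' ω s] at hpow
      change gevTransform _ _ _ = _ * T (ξ ω) s + _
      rw [hstar, gevTransform_unitFrechet,
        negInvLog_eq_mul_negInvLog_pow hn (gevCDF_nonneg _ _) (gevCDF_le_one _ _), hpow]
      simp
    · rw [← Measure.map_map mT hξ, hTdef, map_max_pi_map_comp _ hn, hlaw, Measure.map_map mT hη]
  · rintro ⟨h, -⟩ n hn
    obtain ⟨a, b, η, ha, hη, hη', hlaw⟩ := h n hn
    have hab : ∀ s, a s = n ∧ b s = 0 := fun s =>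
      eq_of_unitFrechetCDF_pow_eq hn (gevCDF_pow_eq hmT hmargins' hn ha hη hη' hlaw s)
    have hA := isUSCFamily_affine ((continuous_gevScale hn).comp hθ)
      ((continuous_gevShift hn).comp hθ) fun s => gevScale_pos hn (θ s)
    refine ⟨_, _, USC.comp _ hA ∘ ξ, fun s => gevScale_pos hn (θ s),
      (USC.measurable_comp _ hA).comp hξ, fun ω s => rfl, ?_⟩
    -- Equality holds only almost surely, since it uses `Q(F(ξ)) = ξ`; that suffices for laws.
    have hT'η : T' ∘ η =ᵐ[P] USC.comp _ hA ∘ ξ := by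
      filter_upwards [hae] with ω hω
      refine USC.ext_of_forall fun s => ?_
      change gevQuantile (unitFrechetCDF (η ω s)) (θ s) =
        (gevScale n (θ s) : EReal) * ξ ω s + (gevShift n (θ s) : EReal)
      have : η ω s = ((n : ℝ) : EReal) * negInvLog (gevCDF (θ s) (ξ ω s)) := by
        rw [hη', (hab s).1, (hab s).2, Function.comp_apply, hstar]
        simp
      rw [this, gevQuantile_unitFrechetCDF_mul hn (gevCDF_nonneg _ _) (gevCDF_le_one _ _), hω]
    rw [← Measure.map_congr hT'η, Measure.map_congr hξT, ← Measure.map_map mT' hmT, hTdef',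
      map_max_pi_map_comp _ hn, hlaw, Measure.map_map mT' hη]
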